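/- Let $N$ be a positive integer, let $M\ge 0$, and let $0<k_1<\dots<k_M<N$ be integers. Put $\Lambda=\{0,\dots,N\}\setminus\{k_1,\dots,k_M\}$ and let $\mathcal P(\Lambda)$ be the space of polynomials $\sum_{k\in\Lambda}c_kz^k$ with complex coefficients, regarded as a subspace of $L^1(\mathbb T)$, $\mathbb T=\{|z|=1\}$, with norm $\|f\|_1=\frac1{2\pi}\int_{\mathbb T}|f(\zeta)|\,|d\zeta|$. A point $\xi$ of the closed unit ball of a complex normed space $X$ is called exposed if there is a functional $\phi\in X^*$ of norm $1$ such that $\xi$ is the only point $x$ of the ball with $\phi(x)=1$. For $p\in\mathcal P(\Lambda)$ with $\|p\|_1=1$, let $p^*(z)=z^N\overline{p(1/\bar z)}$; let $a_1,\dots,a_n$ be the distinct common zeros of $p$ and $p^*$ in the open unit disk; let $m_j$ be the smaller of the multiplicities of $a_j$ as a zero of $p$ and of $p^*$; and put $$m=\sum_j m_j,\qquad G(z)=\prod_j(z-a_j)^{m_j}(1-\bar a_jz)^{m_j},\qquad R=p/G .$$ Let $\zeta_1,\dots,\zeta_\nu$ be the distinct zeros of $p$ on $\mathbb T$, with multiplicities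 $\lambda_j$; put $\mu_j=\lfloor\lambda_j/2\rfloor$ and $$\widetilde m=m+\sum_j\mu_j,\qquad \widetilde G(z)=G(z)\prod_j(z-\zeta_j)^{\mu_j}(1-\bar\zeta_jz)^{\mu_j},\qquad \widetilde R=p/\widetilde G .$$ ($R$ and $\widetilde R$ are polynomials.) For an integer $d\ge0$ and a polynomial $f$ with Fourier coefficients $\widehat f(r)=A(r)+iB(r)$ ($r\in\mathbb Z$; $A(r),B(r)$ real), let $\mathfrak M(d,f)$ be the real $2M\times(2d+1)$ block matrix $$\mathfrak M(d,f)=\begin{pmatrix}\mathcal A^+&\mathcal B^-\\ \mathcal B^+&-\mathcal A^-\end{pmatrix},\qquad \mathcal A^\pm_{j,l}=A(k_j+l-d)\pm A(k_j-l-d),\quad \mathcal B^\pm_{j,l}=B(k_j+l-d)\pm B(k_j-l-d),$$ where $j=1,\dots,M$, and $l=0,\dots,d$ in the plus-blocks and $l=1,\dots,d$ in the minus-blocks. Put $\mathfrak M=\mathfrak M(m,R)$ and $\widetilde{\mathfrak M}=\mathfrak M(\widetilde m,\widetilde R)$. Let $p\in\mathcal P(\Lambda)$ with $\|p\|_1=1$,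 and assume that $p$ has no multiple zeros on $\mathbb T$. Then: 1. $p$ is an exposed point of the closed unit ball of $\mathcal P(\Lambda)$ if and only if it is an extreme point of that ball; 2. $\widetilde m=m$ and $\widetilde{\mathfrak M}=\mathfrak M$; 3. $p$ is an extreme point of the ball if and only if $\operatorname{rank}\mathfrak M=2m$; 4. if $\operatorname{rank}\widetilde{\mathfrak M}=2\widetilde m$, then $p$ is an exposed point of the ball. -/

import Mathlib

open Polynomial MeasureTheory
open scoped Real

attribute [local instance] Polynomial.instTwoPiPos

namespace Fewnomial

noncomputable section

/-- `L¹` of the unit circle, with the normalized Lebesgue measure `dt / 2π`; a point of the circle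
is written `e ^ (i t)` with `t ∈ ℝ / 2πℤ`. -/
abbrev L1Circle : Type := Lp ℂ 1 (AddCircle.haarAddCircle (T := 2 * π))

/-- The restriction to the unit circle of a polynomial, as an element of `L¹`. -/
def toL1 : ℂ[X] →ₗ[ℂ] L1Circle :=
  (ContinuousMap.toLp (E := ℂ) 1 (AddCircle.haarAddCircle (T := 2 * π)) ℂ).toLinearMap ∘ₗ
    Polynomial.toAddCircle.toLinearMap

/-- `Λ = {0, …, N} \ {k₁, …, k_M}`. -/
def freqs (N : ℕ) {M : ℕ} (k : Fin M → ℕ) : Set ℕ :=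
  {n | n ≤ N ∧ ∀ j, n ≠ k j}

/-- The polynomials `∑_{k ∈ Λ} c_k z ^ k` with complex coefficients. -/
def polys (Λ : Set ℕ) : Submodule ℂ ℂ[X] where
  carrier := {p | ∀ n, n ∉ Λ → p.coeff n = 0}
  add_mem' := by
    intro p q hp hq n hn
    simp [hp n hn, hq n hn]
  zero_mem' := by
    intro n _
    simp
  smul_mem' := by
    intro c p hp n hn
    simp [hp n hn]

/-- The space `𝒫(Λ)`, viewed as a subspace of `L¹` (with the norm of `L¹`). -/
def PSpace (Λ : Set ℕ) : Submodule ℂ L1Circle :=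
  (polys Λ).map toL1

/-- A polynomial from `polys Λ`, viewed as a vector of the normed space `𝒫(Λ)`. -/
def toPSpace (Λ : Set ℕ) (p : ℂ[X]) (hp : p ∈ polys Λ) : PSpace Λ :=
  ⟨toL1 p, Submodule.mem_map_of_mem hp⟩

/-- `x` is an extreme point of the closed unit ball of `X`. -/
def IsExtremePt {X : Type*} [NormedAddCommGroup X] [Module ℝ X] (x : X) : Prop :=
  x ∈ Set.extremePoints ℝ (Metric.closedBall (0 : X) 1)

/-- `x` is an exposed point of the closed unit ball of the complex normed space `X`. -/
def IsExposedPt {X : Type*} [NormedAddCommGroup X] [NormedSpace ℂ X] (x : X) : Prop :=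
  ∃ φ : StrongDual ℂ X, ‖φ‖ = 1 ∧ {y ∈ Metric.closedBall (0 : X) 1 | φ y = 1} = {x}

/-- `p*(z) = z ^ N * conj (p (1 / conj z))`, that is, `∑_{k ≤ N} conj (c_k) z ^ (N - k)` if
`p = ∑_{k ≤ N} c_k z ^ k`. -/
def pStar (N : ℕ) (p : ℂ[X]) : ℂ[X] :=
  (p.map (starRingEnd ℂ)).reflect N

open Classical in
/-- The common zeros of `p` and `p*` in the open unit disk (for `p ≠ 0`). -/
def diskZeros (N : ℕ) (p : ℂ[X]) : Finset ℂ :=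
  p.roots.toFinset.filter fun a => ‖a‖ < 1 ∧ (pStar N p).IsRoot a

/-- The multiplicity `min (mult (a, p), mult (a, p*))`. -/
def commonMult (N : ℕ) (p : ℂ[X]) (a : ℂ) : ℕ :=
  min (p.rootMultiplicity a) ((pStar N p).rootMultiplicity a)

/-- The number `m`. -/
def m (N : ℕ) (p : ℂ[X]) : ℕ :=
  ∑ a ∈ diskZeros N p, commonMult N p a

/-- The polynomial `G(z) = ∏ (z - a_j) ^ m_j * (1 - conj a_j * z) ^ m_j`. -/
def G (N : ℕ) (p : ℂ[X]) : ℂ[X] :=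
  ∏ a ∈ diskZeros N p,
    (X - C a) ^ commonMult N p a * (1 - C (starRingEnd ℂ a) * X) ^ commonMult N p a

/-- The polynomial `R = p / G` (`G` divides `p`). -/
def R (N : ℕ) (p : ℂ[X]) : ℂ[X] :=
  p / G N p

open Classical in
/-- The zeros of `p` on the unit circle (for `p ≠ 0`). -/
def circleZeros (p : ℂ[X]) : Finset ℂ :=
  p.roots.toFinset.filter fun ζ => ‖ζ‖ = 1

/-- The integral part of half the multiplicity of the zero `ζ` of `p`. -/
def halfMult (p : ℂ[X]) (ζ : ℂ) : ℕ :=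
  p.rootMultiplicity ζ / 2

/-- The number `m̃ = m + μ`. -/
def mTilde (N : ℕ) (p : ℂ[X]) : ℕ :=
  m N p + ∑ ζ ∈ circleZeros p, halfMult p ζ

/-- The polynomial `G₀(z) = ∏ (z - ζ_j) ^ μ_j * (1 - conj ζ_j * z) ^ μ_j`. -/
def G0 (p : ℂ[X]) : ℂ[X] :=
  ∏ ζ ∈ circleZeros p,
    (X - C ζ) ^ halfMult p ζ * (1 - C (starRingEnd ℂ ζ) * X) ^ halfMult p ζ

/-- The polynomial `G̃ = G * G₀`. -/
def GTilde (N : ℕ) (p : ℂ[X]) : ℂ[X] :=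
  G N p * G0 p

/-- The polynomial `R̃ = p / G̃` (`G̃` divides `p`). -/
def RTilde (N : ℕ) (p : ℂ[X]) : ℂ[X] :=
  p / GTilde N p

/-- The `r`-th Fourier coefficient of (the restriction to the circle of) a polynomial. -/
def coefZ (f : ℂ[X]) (r : ℤ) : ℂ :=
  fourierCoeff (T := 2 * π) f.toAddCircle r

/-- The `2M × (2d+1)` block matrix
`(𝒜⁺  ℬ⁻ ; ℬ⁺  -𝒜⁻)` built from the Fourier coefficients `A(r) + i B(r)` of a polynomial `f`:
`𝒜^±_{j,l} = A(k_j + l - d) ± A(k_j - l - d)` and `ℬ^±_{j,l} = B(k_j + l - d) ± B(k_j - l - d)`,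
where `l` runs from `0` to `d` in the plus-blocks and from `1` to `d` in the minus-blocks. -/
def blockMatrix {M : ℕ} (k : Fin M → ℕ) (d : ℕ) (f : ℂ[X]) :
    Matrix (Fin M ⊕ Fin M) (Fin (d + 1) ⊕ Fin d) ℝ :=
  Matrix.fromBlocks
    (Matrix.of fun (j : Fin M) (l : Fin (d + 1)) =>
      (coefZ f ((k j : ℤ) + (l : ℕ) - d)).re + (coefZ f ((k j : ℤ) - (l : ℕ) - d)).re)
    (Matrix.of fun (j : Fin M) (l : Fin d) =>
      (coefZ f ((k j : ℤ) + ((l : ℕ) + 1) - d)).im - (coefZ f ((k j : ℤ) - ((l : ℕ) + 1) - d)).im)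
    (Matrix.of fun (j : Fin M) (l : Fin (d + 1)) =>
      (coefZ f ((k j : ℤ) + (l : ℕ) - d)).im + (coefZ f ((k j : ℤ) - (l : ℕ) - d)).im)
    (-Matrix.of fun (j : Fin M) (l : Fin d) =>
      (coefZ f ((k j : ℤ) + ((l : ℕ) + 1) - d)).re - (coefZ f ((k j : ℤ) - ((l : ℕ) + 1) - d)).re)

/-- The matrix `𝔐`, with `2M` rows and `2m + 1` columns. -/
def matM (N : ℕ) {M : ℕ} (k : Fin M → ℕ) (p : ℂ[X]) :
    Matrix (Fin M ⊕ Fin M) (Fin (m N p + 1) ⊕ Fin (m N p)) ℝ :=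
  blockMatrix k (m N p) (R N p)

/-- The matrix `𝔐̃`, with `2M` rows and `2m̃ + 1` columns. -/
def matMTilde (N : ℕ) {M : ℕ} (k : Fin M → ℕ) (p : ℂ[X]) :
    Matrix (Fin M ⊕ Fin M) (Fin (mTilde N p + 1) ⊕ Fin (mTilde N p)) ℝ :=
  blockMatrix k (mTilde N p) (RTilde N p)

end

end Fewnomial

/-!
Equality `‖f + g‖₁ = ‖f‖₁ + ‖g‖₁` holds exactly when `f * conj g ≥ 0` on the circle. Hence `p` is an
extreme point iff the only `q ∈ 𝒫(Λ)` with `q * conj p` real and `|q| ≤ |p|` on the circle are the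
real multiples of `p`, and `p` is exposed as soon as `q * conj p ≥ 0` on the circle forces `q` to be
such a multiple.

If `q * conj p` is real on the circle then `q * p* = q* * p`. Comparing zeros, `q = S * R` with `S`
self-inversive of formal degree `2m`, provided `q` vanishes on the circle to at least the order of
`p`, as it does when `|q| ≤ |p|`. When merely `q * conj p ≥ 0`, the orders of `q` and `p` at a point
of the circle have the same parity, which still gives `q = S * R̃` with `S` self-inversive of formal
degree `2m̃`.

The self-inversive `S` of formal degree `2d` form a real space of dimension `2d + 1`, on which
`𝔐(d, f)` is the matrix of `S ↦ (k_j-th coefficient of S * f)_j`. Its kernel contains `G` for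
`(d, f) = (m, R)` and `G̃` for `(m̃, R̃)`, so the rank is `2d` iff the kernel is spanned by that
polynomial, that is, iff `q` must be a real multiple of `p`.
-/

namespace Fewnomial

open AddCircle Filter Topology
open scoped ComplexConjugate ComplexOrder

lemma pStar_mul {N K : ℕ} {p q : ℂ[X]} (hp : p.natDegree ≤ N) (hq : q.natDegree ≤ K) :
    pStar (N + K) (p * q) = pStar N p * pStar K q := by
  simpa only [pStar, Polynomial.map_mul] using
    reflect_mul _ _ (natDegree_map_le.trans hp) (natDegree_map_le.trans hq)

lemma pStar_pow {N : ℕ} {p : ℂ[X]} (hp : p.natDegree ≤ N) (n : ℕ) :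
    pStar (n * N) (p ^ n) = pStar N p ^ n := by
  induction n with
  | zero => simp [pStar]
  | succ n ih =>
    rw [Nat.succ_mul, pow_succ, pow_succ, pStar_mul (natDegree_pow_le_of_le n hp) hp, ih]

lemma pStar_pStar (N : ℕ) (p : ℂ[X]) : pStar N (pStar N p) = p := by
  ext n
  simp [pStar, coeff_reflect]

lemma pStar_ne_zero {N : ℕ} {p : ℂ[X]} (hp : p ≠ 0) : pStar N p ≠ 0 := by
  simpa [pStar] using hp

lemma natDegree_pStar_le {N : ℕ} {p : ℂ[X]} (hp : p.natDegree ≤ N) :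
    (pStar N p).natDegree ≤ N :=
  natDegree_reflect_le.trans (max_le le_rfl (natDegree_map_le.trans hp))

lemma coeff_pStar {N n : ℕ} (hn : n ≤ N) (p : ℂ[X]) :
    (pStar N p).coeff n = conj (p.coeff (N - n)) := by
  simp [pStar, coeff_reflect, revAt_le hn]

lemma eval_pStar {N : ℕ} {p : ℂ[X]} (hp : p.natDegree ≤ N) {z : ℂ} (hz : ‖z‖ = 1) :
    (pStar N p).eval z = z ^ N * conj (p.eval z) := by
  have hz0 : z ≠ 0 := norm_ne_zero_iff.1 (hz ▸ one_ne_zero)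
  let : Invertible z⁻¹ := invertibleOfNonzero (inv_ne_zero hz0)
  have hreflect := eval₂_reflect_mul_pow (RingHom.id ℂ) z⁻¹ N (p.map (starRingEnd ℂ))
    (natDegree_map_le.trans hp)
  simp only [invOf_eq_inv, inv_inv, inv_pow] at hreflect
  have hconj : conj (p.eval z) = eval₂ (RingHom.id ℂ) z⁻¹ (p.map (starRingEnd ℂ)) := by
    rw [Complex.inv_eq_conj hz, ← eval, ← eval₂_eq_eval_map, eval₂_at_apply]
  rw [hconj, ← hreflect]
  simp only [pStar, eval]
  field_simp

lemma pStar_X_sub_C (a : ℂ) : pStar 1 (X - C a) = 1 - C (conj a) * X := by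
  simp [pStar, reflect_sub]

lemma one_sub_C_mul_X_ne_zero (a : ℂ) : (1 - C a * X : ℂ[X]) ≠ 0 := fun h => by
  simpa using congrArg (eval 0) h

lemma rootMultiplicity_le_pStar {N : ℕ} {p : ℂ[X]} (hp0 : p ≠ 0) (hp : p.natDegree ≤ N)
    {w : ℂ} (hw : w ≠ 0) :
    p.rootMultiplicity w ≤ (pStar N p).rootMultiplicity (conj w)⁻¹ := by
  obtain ⟨u, hu, -⟩ := exists_eq_pow_rootMultiplicity_mul_and_not_dvd p hp0 w
  generalize p.rootMultiplicity w = n at hu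
  have hu0 : u ≠ 0 := by
    rintro rfl
    exact hp0 (by simpa using hu)
  have hdeg : p.natDegree = n + u.natDegree := by
    rw [hu, natDegree_mul (pow_ne_zero _ (X_sub_C_ne_zero w)) hu0, natDegree_pow,
      natDegree_X_sub_C, mul_one]
  have hstar : pStar N p = (1 - C (conj w) * X) ^ n * pStar (N - n) u := by
    rw [show N = n * 1 + (N - n) by lia, hu,
      pStar_mul (natDegree_pow_le_of_le n (natDegree_X_sub_C_le w)) (by lia),
      pStar_pow (natDegree_X_sub_C_le w), pStar_X_sub_C]
    simp
  have hfactor : (1 - C (conj w) * X : ℂ[X]) = C (-conj w) * (X - C (conj w)⁻¹) := by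
    have : conj w ≠ 0 := by simpa using hw
    rw [mul_sub, ← C_mul, neg_mul, mul_inv_cancel₀ this]
    simp only [map_neg, map_one]
    ring
  rw [le_rootMultiplicity_iff (pStar_ne_zero hp0), hstar, hfactor, mul_pow]
  exact (Dvd.intro_left _ rfl).mul_right _

lemma rootMultiplicity_pStar {N : ℕ} {p : ℂ[X]} (hp0 : p ≠ 0) (hp : p.natDegree ≤ N)
    {w : ℂ} (hw : w ≠ 0) :
    (pStar N p).rootMultiplicity (conj w)⁻¹ = p.rootMultiplicity w := by
  refine le_antisymm ?_ (rootMultiplicity_le_pStar hp0 hp hw)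
  have h := rootMultiplicity_le_pStar (pStar_ne_zero (N := N) hp0) (natDegree_pStar_le hp)
    (w := (conj w)⁻¹) (by simpa using hw)
  simpa [pStar_pStar] using h

lemma rootMultiplicity_pStar_zero_add_natDegree {N : ℕ} {p : ℂ[X]} (hp0 : p ≠ 0)
    (hp : p.natDegree ≤ N) :
    (pStar N p).rootMultiplicity 0 + p.natDegree = N := by
  set r := pStar p.natDegree p with hr
  have hstar : pStar N p = X ^ (N - p.natDegree) * r := by
    have h := pStar_mul (N := N - p.natDegree) (p := 1) (by simp) (le_refl p.natDegree)
    simpa [hp, hr, pStar] using h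
  have hr0 : r.rootMultiplicity 0 = 0 := by
    refine rootMultiplicity_eq_zero ?_
    rw [IsRoot, ← coeff_zero_eq_eval_zero, hr, coeff_pStar (Nat.zero_le _)]
    simpa using hp0
  have hX : ((X : ℂ[X]) ^ (N - p.natDegree)).rootMultiplicity 0 = N - p.natDegree := by
    simpa using rootMultiplicity_X_sub_C_pow (0 : ℂ) (N - p.natDegree)
  rw [hstar, rootMultiplicity_mul (mul_ne_zero (pow_ne_zero _ X_ne_zero) (pStar_ne_zero hp0)),
    hr0, hX]
  lia

lemma dvd_of_rootMultiplicity_le {f g : ℂ[X]} (hf : f ≠ 0) (hg : g ≠ 0)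
    (h : ∀ w, f.rootMultiplicity w ≤ g.rootMultiplicity w) : f ∣ g := by
  classical
  rw [IsAlgClosed.dvd_iff_roots_le_roots hf hg, Multiset.le_iff_count]
  simpa using h

lemma dvd_of_rootMultiplicity_le_of_norm_le_one {N K : ℕ} {f g : ℂ[X]} (hf0 : f ≠ 0)
    (hf : f.natDegree ≤ N) (hg0 : g ≠ 0) (hg : g.natDegree ≤ K)
    (h : ∀ w, ‖w‖ ≤ 1 → f.rootMultiplicity w ≤ g.rootMultiplicity w)
    (hstar : ∀ w, ‖w‖ < 1 → (pStar N f).rootMultiplicity w ≤ (pStar K g).rootMultiplicity w) :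
    f ∣ g := by
  refine dvd_of_rootMultiplicity_le hf0 hg0 fun w => ?_
  rcases le_or_gt ‖w‖ 1 with hw | hw
  · exact h w hw
  · have hw0 : w ≠ 0 := norm_pos_iff.1 (one_pos.trans hw)
    rw [← rootMultiplicity_pStar hf0 hf hw0, ← rootMultiplicity_pStar hg0 hg hw0]
    exact hstar _ (by simpa using inv_lt_one_of_one_lt₀ hw)

/-- The self-inversive polynomials of order `n`, those with `S* = S` for the reflection `S ↦ S*` of
order `n`; on the unit circle they are `z ^ (n / 2)` times a real function. They form a real, not a
complex, vector space. -/
def selfInversives (n : ℕ) : Submodule ℝ ℂ[X] where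
  carrier := {S | S.natDegree ≤ n ∧ pStar n S = S}
  add_mem' := fun ⟨hf, hf'⟩ ⟨hg, hg'⟩ =>
    ⟨natDegree_add_le_of_degree_le hf hg, by
      rw [pStar, Polynomial.map_add, reflect_add, ← pStar, ← pStar, hf', hg']⟩
  zero_mem' := by simp [pStar]
  smul_mem' := fun c f ⟨hf, hf'⟩ => by
    refine ⟨(natDegree_smul_le c f).trans hf, ?_⟩
    ext i
    have := congrArg (fun g => (c : ℂ) * g.coeff i) hf'
    simpa [pStar, coeff_reflect] using this

instance : SetLike.GradedMonoid selfInversives where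
  one_mem := by simp [selfInversives, pStar]
  mul_mem := fun _ _ _ _ ⟨hf, hf'⟩ ⟨hg, hg'⟩ =>
    ⟨natDegree_mul_le_of_le hf hg, by rw [pStar_mul hf hg, hf', hg']⟩

lemma X_sub_C_mul_one_sub_mem_selfInversives (a : ℂ) :
    (X - C a) * (1 - C (conj a) * X) ∈ selfInversives 2 := by
  have hdeg : (1 - C (conj a) * X : ℂ[X]).natDegree ≤ 1 :=
    pStar_X_sub_C a ▸ natDegree_pStar_le (natDegree_X_sub_C_le a)
  refine ⟨natDegree_mul_le_of_le (natDegree_X_sub_C_le a) hdeg, ?_⟩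
  rw [pStar_mul (N := 1) (natDegree_X_sub_C_le a) hdeg, ← pStar_X_sub_C, pStar_pStar, mul_comm]

lemma im_eval_mul_conj_eq_zero {n : ℕ} {S T : ℂ[X]} (hS : S ∈ selfInversives n)
    (hT : T ∈ selfInversives n) {z : ℂ} (hz : ‖z‖ = 1) :
    (S.eval z * conj (T.eval z)).im = 0 := by
  have h1 := eval_pStar hS.1 hz
  have h2 := eval_pStar hT.1 hz
  rw [hS.2] at h1
  rw [hT.2] at h2
  have hzn : z ^ n * conj (z ^ n) = 1 := by
    rw [Complex.mul_conj, Complex.normSq_eq_norm_sq, norm_pow, hz]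
    simp
  rw [← Complex.conj_eq_iff_im, map_mul, Complex.conj_conj]
  conv_rhs => rw [h1, h2, map_mul, Complex.conj_conj]
  linear_combination (-conj (S.eval z) * T.eval z) * hzn

lemma rootMultiplicity_pow_eq_mul (p : ℂ[X]) (n : ℕ) (w : ℂ) :
    (p ^ n).rootMultiplicity w = n * p.rootMultiplicity w := by
  classical
  rw [← count_roots, ← count_roots, roots_pow, Multiset.count_nsmul]

lemma rootMultiplicity_prod_eq_sum {ι : Type*} {s : Finset ι} {f : ι → ℂ[X]}
    (h : ∀ i ∈ s, f i ≠ 0) (w : ℂ) :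
    (∏ i ∈ s, f i).rootMultiplicity w = ∑ i ∈ s, (f i).rootMultiplicity w := by
  classical
  simp only [← count_roots, roots_prod f s (Finset.prod_ne_zero_iff.2 h), Multiset.count_bind,
    Finset.sum_map_val]

/-- The product of the powers `((z - a) (1 - conj a z)) ^ c a` over `a ∈ s`, which has, counted with
multiplicity, the zeros `a` and their mirror images `1 / conj a` in the unit circle. Both `G` and
`G0` are of this form. -/
noncomputable def symmProd (s : Finset ℂ) (c : ℂ → ℕ) : ℂ[X] :=
  ∏ a ∈ s, (X - C a) ^ c a * (1 - C (conj a) * X) ^ c a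

lemma symmProd_factor_ne_zero (a : ℂ) (n : ℕ) :
    ((X - C a) ^ n * (1 - C (conj a) * X) ^ n : ℂ[X]) ≠ 0 :=
  mul_ne_zero (pow_ne_zero _ (X_sub_C_ne_zero a)) (pow_ne_zero _ (one_sub_C_mul_X_ne_zero _))

lemma symmProd_ne_zero (s : Finset ℂ) (c : ℂ → ℕ) : symmProd s c ≠ 0 :=
  Finset.prod_ne_zero_iff.2 fun a _ => symmProd_factor_ne_zero a (c a)

lemma symmProd_mem_selfInversives (s : Finset ℂ) (c : ℂ → ℕ) :
    symmProd s c ∈ selfInversives (2 * ∑ a ∈ s, c a) := by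
  simp only [symmProd, ← mul_pow, mul_comm 2 (Finset.sum _ _), Finset.sum_mul]
  exact SetLike.prod_mem_graded selfInversives _ _ fun a _ =>
    SetLike.pow_mem_graded (A := selfInversives) (c a) (X_sub_C_mul_one_sub_mem_selfInversives a)

open Classical in
lemma rootMultiplicity_one_sub_C_conj_mul_X (a w : ℂ) :
    (1 - C (conj a) * X : ℂ[X]).rootMultiplicity w = if w * conj a = 1 then 1 else 0 := by
  split_ifs with h
  · have ha : a ≠ 0 := by
      rintro rfl
      simp at h
    rw [eq_inv_of_mul_eq_one_left h, ← pStar_X_sub_C,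
      rootMultiplicity_pStar (X_sub_C_ne_zero a) (natDegree_X_sub_C_le a) ha,
      rootMultiplicity_X_sub_C_self]
  · refine rootMultiplicity_eq_zero fun h0 => h ?_
    have h0 : 1 - conj a * w = 0 := by simpa using h0
    linear_combination -h0

open Classical in
lemma rootMultiplicity_symmProd (s : Finset ℂ) (c : ℂ → ℕ) (w : ℂ) :
    (symmProd s c).rootMultiplicity w = ∑ a ∈ s,
      (c a * (if w = a then 1 else 0) + c a * (if w * conj a = 1 then 1 else 0)) := by
  rw [symmProd, rootMultiplicity_prod_eq_sum fun a _ => symmProd_factor_ne_zero a (c a)]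
  refine Finset.sum_congr rfl fun a _ => ?_
  rw [rootMultiplicity_mul (symmProd_factor_ne_zero a (c a)), rootMultiplicity_pow_eq_mul,
    rootMultiplicity_pow_eq_mul, rootMultiplicity_X_sub_C, rootMultiplicity_one_sub_C_conj_mul_X]

open Classical in
lemma rootMultiplicity_symmProd_of_norm_lt_one {s : Finset ℂ} (hs : ∀ a ∈ s, ‖a‖ ≤ 1) (c : ℂ → ℕ)
    {w : ℂ} (hw : ‖w‖ < 1) :
    (symmProd s c).rootMultiplicity w = if w ∈ s then c w else 0 := by
  rw [rootMultiplicity_symmProd, ← Finset.sum_ite_eq s w c]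
  refine Finset.sum_congr rfl fun a ha => ?_
  have hmirror : w * conj a ≠ 1 := fun h => by
    have h := congrArg norm h
    rw [norm_mul, RCLike.norm_conj, norm_one] at h
    nlinarith [norm_nonneg w, hs a ha]
  simp [hmirror]

open Classical in
lemma rootMultiplicity_symmProd_of_norm_eq_one (s : Finset ℂ) (c : ℂ → ℕ) {w : ℂ} (hw : ‖w‖ = 1) :
    (symmProd s c).rootMultiplicity w = 2 * if w ∈ s then c w else 0 := by
  rw [rootMultiplicity_symmProd, ← Finset.sum_ite_eq s w c, Finset.mul_sum]
  refine Finset.sum_congr rfl fun a _ => ?_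
  have hmirror : w * conj a = 1 ↔ w = a := by
    rw [mul_eq_one_iff_inv_eq₀ (norm_ne_zero_iff.1 (hw ▸ one_ne_zero)), Complex.inv_eq_conj hw,
      (starRingEnd ℂ).injective.eq_iff]
  simp only [hmirror, mul_ite, mul_one, mul_zero]
  split_ifs <;> ring

section

variable {N : ℕ} {p : ℂ[X]}

lemma G_ne_zero : G N p ≠ 0 :=
  symmProd_ne_zero _ _

lemma GTilde_ne_zero : GTilde N p ≠ 0 :=
  mul_ne_zero (symmProd_ne_zero _ _) (symmProd_ne_zero _ _)

lemma G_mem_selfInversives : G N p ∈ selfInversives (2 * m N p) :=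
  symmProd_mem_selfInversives _ _

lemma GTilde_mem_selfInversives : GTilde N p ∈ selfInversives (2 * mTilde N p) := by
  rw [mTilde, mul_add]
  exact SetLike.mul_mem_graded G_mem_selfInversives (symmProd_mem_selfInversives _ _)

lemma norm_lt_one_of_mem_diskZeros {a : ℂ} (h : a ∈ diskZeros N p) : ‖a‖ < 1 :=
  (Finset.mem_filter.1 h).2.1

lemma norm_eq_one_of_mem_circleZeros {ζ : ℂ} (h : ζ ∈ circleZeros p) : ‖ζ‖ = 1 :=
  (Finset.mem_filter.1 h).2

lemma mem_diskZeros_of_commonMult_ne_zero {w : ℂ} (hw : ‖w‖ < 1) (h : commonMult N p w ≠ 0) :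
    w ∈ diskZeros N p := by
  have hp : 0 < p.rootMultiplicity w := by grind [commonMult]
  have hstar : 0 < (pStar N p).rootMultiplicity w := by grind [commonMult]
  have hp0 : p ≠ 0 := by
    rintro rfl
    simp at hp
  simp only [diskZeros, Finset.mem_filter, Multiset.mem_toFinset, mem_roots hp0]
  exact ⟨(rootMultiplicity_pos hp0).1 hp, hw, (rootMultiplicity_pos (pStar_ne_zero hp0)).1 hstar⟩

lemma mem_circleZeros_of_halfMult_ne_zero {ζ : ℂ} (hζ : ‖ζ‖ = 1) (h : halfMult p ζ ≠ 0) :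
    ζ ∈ circleZeros p := by
  have hp : 0 < p.rootMultiplicity ζ := by grind [halfMult]
  have hp0 : p ≠ 0 := by
    rintro rfl
    simp at hp
  simp only [circleZeros, Finset.mem_filter, Multiset.mem_toFinset, mem_roots hp0]
  exact ⟨(rootMultiplicity_pos hp0).1 hp, hζ⟩

lemma rootMultiplicity_G_of_norm_lt_one {w : ℂ} (hw : ‖w‖ < 1) :
    (G N p).rootMultiplicity w = commonMult N p w := by
  classical
  refine (rootMultiplicity_symmProd_of_norm_lt_one
    (fun a ha => (norm_lt_one_of_mem_diskZeros ha).le) _ hw).trans ?_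
  exact ite_eq_left_iff.2 fun h =>
    by_contra fun h0 => h (mem_diskZeros_of_commonMult_ne_zero hw (Ne.symm h0))

lemma rootMultiplicity_G_of_norm_eq_one {w : ℂ} (hw : ‖w‖ = 1) :
    (G N p).rootMultiplicity w = 0 := by
  classical
  refine (rootMultiplicity_symmProd_of_norm_eq_one _ _ hw).trans ?_
  rw [if_neg fun h => (norm_lt_one_of_mem_diskZeros h).ne hw]

lemma rootMultiplicity_GTilde_of_norm_lt_one {w : ℂ} (hw : ‖w‖ < 1) :
    (GTilde N p).rootMultiplicity w = commonMult N p w := by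
  classical
  have hG0 : (G0 p).rootMultiplicity w = 0 :=
    (rootMultiplicity_symmProd_of_norm_lt_one
      (fun a ha => (norm_eq_one_of_mem_circleZeros ha).le) _ hw).trans
      (if_neg fun h => hw.ne (norm_eq_one_of_mem_circleZeros h))
  rw [GTilde, rootMultiplicity_mul GTilde_ne_zero, rootMultiplicity_G_of_norm_lt_one hw, hG0,
    add_zero]

lemma rootMultiplicity_GTilde_of_norm_eq_one {w : ℂ} (hw : ‖w‖ = 1) :
    (GTilde N p).rootMultiplicity w = 2 * halfMult p w := by
  classical
  have hG0 : (G0 p).rootMultiplicity w = 2 * halfMult p w := by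
    refine (rootMultiplicity_symmProd_of_norm_eq_one _ _ hw).trans (congrArg (2 * ·) ?_)
    exact ite_eq_left_iff.2 fun h =>
      by_contra fun h0 => h (mem_circleZeros_of_halfMult_ne_zero hw (Ne.symm h0))
  rw [GTilde, rootMultiplicity_mul GTilde_ne_zero, rootMultiplicity_G_of_norm_eq_one hw, hG0,
    zero_add]

lemma dvd_of_rootMultiplicity_le_commonMult {n : ℕ} {Γ : ℂ[X]} (hp0 : p ≠ 0)
    (hp : p.natDegree ≤ N) (hΓ0 : Γ ≠ 0) (hΓ : Γ ∈ selfInversives n)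
    (hdisk : ∀ w, ‖w‖ < 1 → Γ.rootMultiplicity w = commonMult N p w)
    (hcirc : ∀ w, ‖w‖ = 1 → Γ.rootMultiplicity w ≤ p.rootMultiplicity w) :
    Γ ∣ p := by
  refine dvd_of_rootMultiplicity_le_of_norm_le_one hΓ0 hΓ.1 hp0 hp (fun w hw => ?_) fun w hw => ?_
  · rcases hw.lt_or_eq with hw | hw
    · exact (hdisk w hw).trans_le (min_le_left _ _)
    · exact hcirc w hw
  · rw [hΓ.2]
    exact (hdisk w hw).trans_le (min_le_right _ _)

lemma G_mul_R (hp0 : p ≠ 0) (hp : p.natDegree ≤ N) : G N p * R N p = p :=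
  EuclideanDomain.mul_div_cancel' G_ne_zero <|
    dvd_of_rootMultiplicity_le_commonMult hp0 hp G_ne_zero G_mem_selfInversives
      (fun _ => rootMultiplicity_G_of_norm_lt_one) fun w hw => by
        simp [rootMultiplicity_G_of_norm_eq_one hw]

lemma GTilde_mul_RTilde (hp0 : p ≠ 0) (hp : p.natDegree ≤ N) : GTilde N p * RTilde N p = p :=
  EuclideanDomain.mul_div_cancel' GTilde_ne_zero <|
    dvd_of_rootMultiplicity_le_commonMult hp0 hp GTilde_ne_zero GTilde_mem_selfInversives
      (fun _ => rootMultiplicity_GTilde_of_norm_lt_one) fun w hw => by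
        rw [rootMultiplicity_GTilde_of_norm_eq_one hw]
        exact Nat.mul_div_le _ _

lemma natDegree_add_natDegree_R_le (hp0 : p ≠ 0) (hp : p.natDegree ≤ N) :
    2 * m N p + (R N p).natDegree ≤ N := by
  -- As `G` is self-inversive, its degree falls short of `2 * m` by its multiplicity at `0`.
  have hG := rootMultiplicity_pStar_zero_add_natDegree (G_ne_zero (N := N) (p := p))
    G_mem_selfInversives.1
  rw [(G_mem_selfInversives (N := N) (p := p)).2,
    rootMultiplicity_G_of_norm_lt_one (by simp), commonMult] at hG
  have hR : R N p ≠ 0 := fun h => hp0 (by rw [← G_mul_R hp0 hp, h, mul_zero])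
  have hdeg := natDegree_mul (G_ne_zero (N := N) (p := p)) hR
  rw [G_mul_R hp0 hp] at hdeg
  have := rootMultiplicity_pStar_zero_add_natDegree hp0 hp
  lia

lemma dvd_mul_of_mul_pStar_eq {n : ℕ} {Γ f : ℂ[X]} (hp0 : p ≠ 0) (hp : p.natDegree ≤ N)
    (hΓ0 : Γ ≠ 0) (hΓ : Γ ∈ selfInversives n)
    (hdisk : ∀ w, ‖w‖ < 1 → Γ.rootMultiplicity w = commonMult N p w)
    (hf0 : f ≠ 0) (hf : f.natDegree ≤ N) (hreal : f * pStar N p = pStar N f * p)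
    (hcirc : ∀ w, ‖w‖ = 1 → p.rootMultiplicity w ≤ f.rootMultiplicity w + Γ.rootMultiplicity w) :
    p ∣ f * Γ := by
  have hmult (w : ℂ) := congrArg (rootMultiplicity w) hreal
  have hfp : f * pStar N p ≠ 0 := mul_ne_zero hf0 (pStar_ne_zero hp0)
  have hpf : pStar N f * p ≠ 0 := mul_ne_zero (pStar_ne_zero hf0) hp0
  have hfΓ : f * Γ ≠ 0 := mul_ne_zero hf0 hΓ0
  simp only [rootMultiplicity_mul hfp, rootMultiplicity_mul hpf] at hmult
  refine dvd_of_rootMultiplicity_le_of_norm_le_one hp0 hp hfΓ (natDegree_mul_le_of_le hf hΓ.1)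
    (fun w hw => ?_) fun w hw => ?_
  · rw [rootMultiplicity_mul hfΓ]
    rcases hw.lt_or_eq with hw | hw
    · grind [commonMult]
    · exact hcirc w hw
  · rw [pStar_mul hf hΓ.1, hΓ.2, rootMultiplicity_mul (mul_ne_zero (pStar_ne_zero hf0) hΓ0)]
    grind [commonMult]

lemma exists_selfInversive_mul_eq {n : ℕ} {Γ Q f : ℂ[X]} (hp0 : p ≠ 0) (hp : p.natDegree ≤ N)
    (hΓ : Γ ∈ selfInversives n) (hΓQ : Γ * Q = p)
    (hdisk : ∀ w, ‖w‖ < 1 → Γ.rootMultiplicity w = commonMult N p w)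
    (hf0 : f ≠ 0) (hf : f.natDegree ≤ N) (hreal : f * pStar N p = pStar N f * p)
    (hcirc : ∀ w, ‖w‖ = 1 → p.rootMultiplicity w ≤ f.rootMultiplicity w + Γ.rootMultiplicity w) :
    ∃ S ∈ selfInversives n, S * Q = f := by
  have hΓ0 : Γ ≠ 0 := left_ne_zero_of_mul (hΓQ ▸ hp0)
  obtain ⟨S, hS⟩ := dvd_mul_of_mul_pStar_eq hp0 hp hΓ0 hΓ hdisk hf0 hf hreal hcirc
  have hS0 : S ≠ 0 := right_ne_zero_of_mul (hS ▸ mul_ne_zero hf0 hΓ0)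
  have hdeg : S.natDegree ≤ n := by
    have hadd := congrArg natDegree hS
    rw [natDegree_mul hf0 hΓ0, natDegree_mul hp0 hS0] at hadd
    have hmult := congrArg (rootMultiplicity 0) hreal
    rw [rootMultiplicity_mul (mul_ne_zero hf0 (pStar_ne_zero hp0)),
      rootMultiplicity_mul (mul_ne_zero (pStar_ne_zero hf0) hp0)] at hmult
    have hΓdeg := rootMultiplicity_pStar_zero_add_natDegree hΓ0 hΓ.1
    rw [hΓ.2, hdisk 0 (by simp), commonMult] at hΓdeg
    have hpdeg := rootMultiplicity_pStar_zero_add_natDegree hp0 hp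
    have hfdeg := rootMultiplicity_pStar_zero_add_natDegree hf0 hf
    lia
  refine ⟨S, ⟨hdeg, ?_⟩, mul_left_cancel₀ hΓ0 ?_⟩
  · have hstar : pStar N f * Γ = pStar N p * pStar n S := by
      rw [← pStar_mul hp hdeg, ← hS, pStar_mul hf hΓ.1, hΓ.2]
    refine mul_left_cancel₀ (mul_ne_zero hp0 (pStar_ne_zero (N := N) hp0)) ?_
    linear_combination (-p) * hstar - Γ * hreal + pStar N p * hS
  · linear_combination S * hΓQ - hS

end

lemma rank_add_one_eq_card_iff {K ι κ : Type*} [Field K] [Fintype κ] (A : Matrix ι κ K)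
    {w : κ → K} (hw0 : w ≠ 0) (hw : A.mulVec w = 0) :
    A.rank + 1 = Fintype.card κ ↔ ∀ v, A.mulVec v = 0 → ∃ c : K, c • w = v := by
  have hrank := A.mulVecLin.finrank_range_add_finrank_ker
  have hker := finrank_eq_one_iff_of_nonzero' (K := K)
    (⟨w, hw⟩ : LinearMap.ker A.mulVecLin) (fun h => hw0 (congrArg Subtype.val h))
  rw [Module.finrank_fintype_fun_eq_card] at hrank
  have hiff : A.rank + 1 = Fintype.card κ ↔
      Module.finrank K (LinearMap.ker A.mulVecLin) = 1 := by
    rw [Matrix.rank]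
    lia
  simp only [hiff, hker, Subtype.forall, LinearMap.mem_ker, Matrix.mulVecLin_apply,
    Subtype.ext_iff, Submodule.coe_smul]

lemma coeff_X_pow_mul_eq_coefZ (f : ℂ[X]) (n r : ℕ) :
    (X ^ r * f).coeff n = coefZ f ((n : ℤ) - r) := by
  rw [coeff_X_pow_mul', coefZ, fourierCoeff_toAddCircle]
  split_ifs
  · congr 1
    lia
  all_goals lia

/-- The basis of the real space of self-inversive polynomials of order `2 * d` which is indexed by
the columns of `blockMatrix k d f`. -/
noncomputable def selfInversiveBasis (d : ℕ) : Fin (d + 1) ⊕ Fin d → ℂ[X] :=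
  Sum.elim (fun l => X ^ (d + l : ℕ) + X ^ (d - l : ℕ))
    fun l => C Complex.I * (X ^ (d + (l + 1) : ℕ) - X ^ (d - (l + 1) : ℕ))

/-- The self-inversive polynomial of order `2 * d` with the given coordinates in
`selfInversiveBasis d`. -/
noncomputable def selfInversive (d : ℕ) : (Fin (d + 1) ⊕ Fin d → ℝ) →ₗ[ℝ] ℂ[X] :=
  Fintype.linearCombination ℝ (selfInversiveBasis d)

lemma selfInversiveBasis_mem (d : ℕ) (c : Fin (d + 1) ⊕ Fin d) :
    selfInversiveBasis d c ∈ selfInversives (2 * d) := by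
  rcases c with l | l
  · have hl := l.2
    refine ⟨natDegree_add_le_of_degree_le ?_ ?_, ?_⟩
    · rw [natDegree_X_pow]; lia
    · rw [natDegree_X_pow]; lia
    · simp only [selfInversiveBasis, Sum.elim_inl, pStar, Polynomial.map_add, Polynomial.map_pow,
        map_X, reflect_add, reflect_monomial]
      rw [revAt_le (by lia), revAt_le (by lia), add_comm]
      congr 2 <;> lia
  · have hl := l.2
    refine ⟨(natDegree_C_mul_le _ _).trans
      ((natDegree_sub_le_of_le ?_ ?_).trans_eq (max_self _)), ?_⟩
    · rw [natDegree_X_pow]; lia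
    · rw [natDegree_X_pow]; lia
    · simp only [selfInversiveBasis, Sum.elim_inr, pStar, Polynomial.map_mul, map_C,
        Polynomial.map_sub, Polynomial.map_pow, map_X, reflect_C_mul, reflect_sub,
        reflect_monomial, Complex.conj_I]
      rw [revAt_le (by lia), revAt_le (by lia), C_neg, neg_mul, ← mul_neg, neg_sub]
      congr 3 <;> lia

lemma selfInversive_mem (d : ℕ) (v : Fin (d + 1) ⊕ Fin d → ℝ) :
    selfInversive d v ∈ selfInversives (2 * d) := by
  rw [selfInversive, Fintype.linearCombination_apply]
  exact sum_mem fun c _ => Submodule.smul_mem _ _ (selfInversiveBasis_mem d c)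

lemma coeff_selfInversive_middle (d : ℕ) (v : Fin (d + 1) ⊕ Fin d → ℝ) :
    (selfInversive d v).coeff d = 2 * v (Sum.inl 0) := by
  rw [selfInversive, Fintype.linearCombination_apply, finsetSum_coeff, Fintype.sum_sum_type,
    Finset.sum_eq_single 0, Finset.sum_eq_zero]
  · simp [selfInversiveBasis, mul_comm, ← two_mul]
  · intro l _
    have := l.2
    simp [selfInversiveBasis, coeff_X_pow, show d ≠ d - (l + 1) by lia]
  · intro l _ hl
    have := l.2
    have h0 : (l : ℕ) ≠ 0 := fun h => hl (Fin.ext h)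
    simp [selfInversiveBasis, coeff_X_pow, h0, show d ≠ d - l by lia]
  · simp

lemma coeff_selfInversive_upper (d : ℕ) (v : Fin (d + 1) ⊕ Fin d → ℝ) (i : Fin d) :
    (selfInversive d v).coeff (d + (i + 1)) =
      v (Sum.inl i.succ) + v (Sum.inr i) * Complex.I := by
  rw [selfInversive, Fintype.linearCombination_apply, finsetSum_coeff, Fintype.sum_sum_type,
    Finset.sum_eq_single i.succ, Finset.sum_eq_single i]
  · simp [selfInversiveBasis, coeff_X_pow, show d + (i + 1 : ℕ) ≠ d - (i + 1) by lia]
  · intro l _ hl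
    have h0 : (i : ℕ) ≠ l := fun h => hl (Fin.ext h.symm)
    simp [selfInversiveBasis, coeff_X_pow, h0, show d + (i + 1 : ℕ) ≠ d - (l + 1) by lia]
  · simp
  · intro l _ hl
    have h0 : (i + 1 : ℕ) ≠ l := fun h => hl (Fin.ext (by simpa using h.symm))
    simp [selfInversiveBasis, coeff_X_pow, h0, show d + (i + 1 : ℕ) ≠ d - l by lia]
  · simp

lemma selfInversive_injective (d : ℕ) : Function.Injective (selfInversive d) := by
  refine (injective_iff_map_eq_zero _).2 fun v hv => ?_
  have hmiddle := coeff_selfInversive_middle d v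
  have hupper (i : Fin d) := Complex.ext_iff.1 (coeff_selfInversive_upper d v i)
  simp only [hv, coeff_zero] at hmiddle hupper
  ext (l | l)
  · refine Fin.cases ?_ (fun i => ?_) l
    · simpa using hmiddle.symm
    · simpa using (hupper i).1.symm
  · simpa using (hupper l).2.symm

lemma ext_selfInversives {d : ℕ} {S T : ℂ[X]} (hS : S ∈ selfInversives (2 * d))
    (hT : T ∈ selfInversives (2 * d)) (h : ∀ i ≤ d, S.coeff (d + i) = T.coeff (d + i)) :
    S = T := by
  ext n
  rcases le_total d n with hn | hn
  · rcases le_or_gt n (2 * d) with hn' | hn'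
    · simpa [hn] using h (n - d) (by lia)
    · rw [coeff_eq_zero_of_natDegree_lt (hS.1.trans_lt hn'),
        coeff_eq_zero_of_natDegree_lt (hT.1.trans_lt hn')]
  · rw [← hS.2, ← hT.2, coeff_pStar (by lia), coeff_pStar (by lia),
      show 2 * d - n = d + (d - n) by lia, h _ (by lia)]

lemma exists_selfInversive_eq {d : ℕ} {S : ℂ[X]} (hS : S ∈ selfInversives (2 * d)) :
    ∃ v, selfInversive d v = S := by
  refine ⟨Sum.elim (Fin.cons ((S.coeff d).re / 2) fun i => (S.coeff (d + (i + 1))).re)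
    fun i => (S.coeff (d + (i + 1))).im, ext_selfInversives (selfInversive_mem d _) hS ?_⟩
  rintro (_ | i) hi
  · have hreal : ((S.coeff d).re : ℂ) = S.coeff d := by
      rw [← Complex.conj_eq_iff_re]
      conv_rhs => rw [← hS.2, coeff_pStar (by lia), show 2 * d - d = d by lia]
    rw [add_zero, coeff_selfInversive_middle, Sum.elim_inl, Fin.cons_zero, Complex.ofReal_div,
      hreal, Complex.ofReal_ofNat]
    ring
  · rw [coeff_selfInversive_upper d _ ⟨i, hi⟩]
    exact Complex.re_add_im _

lemma coeff_selfInversiveBasis_mul (d : ℕ) (f : ℂ[X]) (n : ℕ) :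
    (fun c => (selfInversiveBasis d c * f).coeff n) =
      Sum.elim
        (fun l : Fin (d + 1) => coefZ f ((n : ℤ) - l - d) + coefZ f ((n : ℤ) + l - d))
        fun l : Fin d => Complex.I *
          (coefZ f ((n : ℤ) - (l + 1) - d) - coefZ f ((n : ℤ) + (l + 1) - d)) := by
  ext (l | l)
  · have := l.2
    simp only [selfInversiveBasis, Sum.elim_inl, add_mul, coeff_add, coeff_X_pow_mul_eq_coefZ]
    congr 2 <;> lia
  · have := l.2
    simp only [selfInversiveBasis, Sum.elim_inr, mul_assoc, coeff_C_mul, sub_mul, coeff_sub,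
      coeff_X_pow_mul_eq_coefZ]
    congr 3 <;> lia

section

variable {M : ℕ} (k : Fin M → ℕ) (d : ℕ) (f : ℂ[X])

lemma blockMatrix_inl_apply (j : Fin M) (c : Fin (d + 1) ⊕ Fin d) :
    blockMatrix k d f (Sum.inl j) c = ((selfInversiveBasis d c * f).coeff (k j)).re := by
  rw [congrFun (coeff_selfInversiveBasis_mul d f (k j)) c]
  rcases c with l | l
  · simp [blockMatrix, add_comm]
  · simp [blockMatrix]

lemma blockMatrix_inr_apply (j : Fin M) (c : Fin (d + 1) ⊕ Fin d) :
    blockMatrix k d f (Sum.inr j) c = ((selfInversiveBasis d c * f).coeff (k j)).im := by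
  rw [congrFun (coeff_selfInversiveBasis_mul d f (k j)) c]
  rcases c with l | l
  · simp [blockMatrix, add_comm]
  · simp [blockMatrix]

lemma blockMatrix_mulVec_eq_zero_iff (v : Fin (d + 1) ⊕ Fin d → ℝ) :
    (blockMatrix k d f).mulVec v = 0 ↔ ∀ j, (selfInversive d v * f).coeff (k j) = 0 := by
  have hcoeff (j : Fin M) : (selfInversive d v * f).coeff (k j) =
      ∑ c, (selfInversiveBasis d c * f).coeff (k j) * v c := by
    rw [selfInversive, Fintype.linearCombination_apply, Finset.sum_mul, finsetSum_coeff]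
    refine Finset.sum_congr rfl fun c _ => ?_
    rw [smul_mul_assoc, coeff_smul, Complex.real_smul, mul_comm]
  simp only [funext_iff, Sum.forall, Matrix.mulVec, dotProduct, blockMatrix_inl_apply,
    blockMatrix_inr_apply, Pi.zero_apply, ← forall_and, Complex.ext_iff, hcoeff, Complex.re_sum,
    Complex.im_sum, Complex.re_mul_ofReal, Complex.im_mul_ofReal, Complex.zero_re, Complex.zero_im]

lemma rank_blockMatrix_eq_iff {Γ : ℂ[X]} (hΓ0 : Γ ≠ 0) (hΓ : Γ ∈ selfInversives (2 * d))
    (hcoeff : ∀ j, (Γ * f).coeff (k j) = 0) :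
    (blockMatrix k d f).rank = 2 * d ↔
      ∀ S ∈ selfInversives (2 * d), (∀ j, (S * f).coeff (k j) = 0) → ∃ c : ℝ, c • Γ = S := by
  obtain ⟨w, rfl⟩ := exists_selfInversive_eq hΓ
  have hw0 : w ≠ 0 := by
    rintro rfl
    exact hΓ0 (map_zero _)
  have hrank := rank_add_one_eq_card_iff (blockMatrix k d f) hw0
    ((blockMatrix_mulVec_eq_zero_iff k d f w).2 hcoeff)
  have hcard : Fintype.card (Fin (d + 1) ⊕ Fin d) = 2 * d + 1 := by
    simp only [Fintype.card_sum, Fintype.card_fin]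
    lia
  rw [hcard, add_left_inj] at hrank
  rw [hrank]
  simp only [blockMatrix_mulVec_eq_zero_iff]
  constructor
  · intro h S hS hSf
    obtain ⟨v, rfl⟩ := exists_selfInversive_eq hS
    obtain ⟨c, rfl⟩ := h v hSf
    exact ⟨c, (map_smul _ c w).symm⟩
  · intro h v hv
    obtain ⟨c, hc⟩ := h _ (selfInversive_mem d v) hv
    exact ⟨c, selfInversive_injective d (by rw [map_smul, hc])⟩

end

lemma tendsto_circle_chord_div (ζ : ℂ) :
    Tendsto (fun s : ℝ => (ζ * Complex.exp (s * Complex.I) - ζ) / s) (𝓝[≠] 0)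
      (𝓝 (ζ * Complex.I)) := by
  have hderiv : HasDerivAt (fun s : ℝ => ζ * Complex.exp (s * Complex.I)) (ζ * Complex.I) 0 := by
    simpa using ((Complex.ofRealCLM.hasDerivAt (x := 0)).mul_const Complex.I).cexp.const_mul ζ
  refine hderiv.tendsto_slope.congr fun s => ?_
  simp [slope_def_module, div_eq_inv_mul]

lemma exists_tendsto_eval_div_pow_rootMultiplicity {f : ℂ[X]} (hf : f ≠ 0) {ζ : ℂ} (hζ : ζ ≠ 0) :
    ∃ c ≠ 0, Tendsto (fun s : ℝ => f.eval (ζ * Complex.exp (s * Complex.I)) /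
      (s : ℂ) ^ f.rootMultiplicity ζ) (𝓝[≠] 0) (𝓝 c) := by
  obtain ⟨u, hu, hdvd⟩ := exists_eq_pow_rootMultiplicity_mul_and_not_dvd f hf ζ
  generalize f.rootMultiplicity ζ = n at hu ⊢
  subst hu
  have hcurve : Tendsto (fun s : ℝ => ζ * Complex.exp (s * Complex.I)) (𝓝[≠] 0) (𝓝 ζ) := by
    have : Continuous fun s : ℝ => ζ * Complex.exp (s * Complex.I) := by fun_prop
    simpa using (this.tendsto 0).mono_left nhdsWithin_le_nhds
  refine ⟨(ζ * Complex.I) ^ n * u.eval ζ,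
    mul_ne_zero (pow_ne_zero _ (mul_ne_zero hζ Complex.I_ne_zero))
      (by rwa [dvd_iff_isRoot] at hdvd),
    (((tendsto_circle_chord_div ζ).pow _).mul ((u.continuous.tendsto ζ).comp hcurve)).congr
      fun s => ?_⟩
  simp only [eval_mul, eval_pow, eval_sub, eval_X, eval_C, Function.comp_apply, div_pow]
  ring

lemma norm_mul_exp_ofReal_mul_I {ζ : ℂ} (hζ : ‖ζ‖ = 1) (s : ℝ) :
    ‖ζ * Complex.exp (s * Complex.I)‖ = 1 := by
  rw [norm_mul, hζ, Complex.norm_exp_ofReal_mul_I, one_mul]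

lemma rootMultiplicity_le_of_norm_eval_le {f p : ℂ[X]} (hf : f ≠ 0) {B : ℝ}
    (h : ∀ z : ℂ, ‖z‖ = 1 → ‖f.eval z‖ ≤ B * ‖p.eval z‖) {ζ : ℂ} (hζ : ‖ζ‖ = 1) :
    p.rootMultiplicity ζ ≤ f.rootMultiplicity ζ := by
  rcases eq_or_ne p 0 with rfl | hp
  · simp
  have hζ0 : ζ ≠ 0 := norm_ne_zero_iff.1 (hζ ▸ one_ne_zero)
  obtain ⟨a, ha, hfa⟩ := exists_tendsto_eval_div_pow_rootMultiplicity hf hζ0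
  obtain ⟨b, -, hpb⟩ := exists_tendsto_eval_div_pow_rootMultiplicity hp hζ0
  by_contra! hlt
  obtain ⟨r, hr, hpf⟩ : ∃ r ≠ 0, p.rootMultiplicity ζ = f.rootMultiplicity ζ + r :=
    ⟨_, Nat.sub_ne_zero_of_lt hlt, (Nat.add_sub_cancel' hlt.le).symm⟩
  have hpow : Tendsto (fun s : ℝ => ‖(s : ℂ) ^ r‖) (𝓝[≠] 0) (𝓝 0) := by
    have : Continuous fun s : ℝ => ‖(s : ℂ) ^ r‖ := by fun_prop
    simpa [hr] using (this.tendsto 0).mono_left nhdsWithin_le_nhds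
  have hlim := (hpb.norm.const_mul B).mul hpow
  rw [mul_zero] at hlim
  refine ha (norm_le_zero_iff.1 (le_of_tendsto_of_tendsto hfa.norm hlim ?_))
  filter_upwards [self_mem_nhdsWithin] with s hs
  have hs : 0 < ‖(s : ℂ)‖ := by simpa using hs
  rw [hpf, norm_div, norm_div, norm_pow, norm_pow, norm_pow, pow_add, mul_assoc, div_mul_eq_mul_div,
    mul_div_mul_right _ _ (pow_pos hs r).ne', ← mul_div_assoc]
  gcongr
  exact h _ (norm_mul_exp_ofReal_mul_I hζ s)

lemma even_rootMultiplicity_add_of_nonneg {f p : ℂ[X]} (hf : f ≠ 0) (hp : p ≠ 0)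
    (h : ∀ z : ℂ, ‖z‖ = 1 → 0 ≤ f.eval z * conj (p.eval z)) {ζ : ℂ} (hζ : ‖ζ‖ = 1) :
    Even (f.rootMultiplicity ζ + p.rootMultiplicity ζ) := by
  have hζ0 : ζ ≠ 0 := norm_ne_zero_iff.1 (hζ ▸ one_ne_zero)
  obtain ⟨a, ha, hfa⟩ := exists_tendsto_eval_div_pow_rootMultiplicity hf hζ0
  obtain ⟨b, hb, hpb⟩ := exists_tendsto_eval_div_pow_rootMultiplicity hp hζ0
  by_contra hodd
  rw [Nat.not_even_iff_odd] at hodd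
  have hlim := hfa.mul hpb.star
  simp only [← starRingEnd_apply, map_div₀, map_pow, Complex.conj_ofReal, div_mul_div_comm,
    ← pow_add] at hlim
  have hnonneg (s : ℝ) := h _ (norm_mul_exp_ofReal_mul_I hζ s)
  have hge : 0 ≤ a * conj b := by
    refine ge_of_tendsto (hlim.mono_left (nhdsGT_le_nhdsNE 0)) ?_
    filter_upwards [self_mem_nhdsWithin] with s (hs : 0 < s)
    have hpow := pow_pos hs (f.rootMultiplicity ζ + p.rootMultiplicity ζ)
    exact div_nonneg (hnonneg s) (mod_cast hpow.le)
  have hle : a * conj b ≤ 0 := by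
    refine le_of_tendsto (hlim.mono_left (nhdsLT_le_nhdsNE 0)) ?_
    filter_upwards [self_mem_nhdsWithin] with s (hs : s < 0)
    have hpow := neg_pos.2 (hodd.pow_neg hs)
    rw [← neg_nonneg, ← div_neg]
    exact div_nonneg (hnonneg s) (mod_cast hpow.le)
  exact mul_ne_zero ha (by simpa using hb) (le_antisymm hle hge)

lemma toAddCircle_apply (f : ℂ[X]) (t : AddCircle (2 * π)) :
    f.toAddCircle t = f.eval (t.toCircle : ℂ) := by
  rw [← coe_aeval_eq_eval]
  exact (aeval_algHom_apply (ContinuousMap.evalAlgHom ℂ ℂ t) _ f).symm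

lemma forall_toCircle_iff {P : ℂ → Prop} :
    (∀ t : AddCircle (2 * π), P t.toCircle) ↔ ∀ z : ℂ, ‖z‖ = 1 → P z := by
  refine ⟨fun h z hz => ?_, fun h t => h _ (Circle.norm_coe _)⟩
  obtain ⟨t, ht⟩ :=
    (homeomorphCircle Real.two_pi_pos.ne').surjective ⟨z, mem_sphere_zero_iff_norm.2 hz⟩
  have := h t
  rwa [← homeomorphCircle_apply Real.two_pi_pos.ne', ht] at this

lemma toL1_injective : Function.Injective toL1 := by
  intro f g hfg
  have hcont : f.toAddCircle = g.toAddCircle :=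
    ContinuousMap.toLp_injective (p := 1) (𝕜 := ℂ) haarAddCircle hfg
  ext n
  rw [← fourierCoeff_toAddCircle_natCast, hcont, fourierCoeff_toAddCircle_natCast]

lemma eq_of_eval_eq_on_circle {f g : ℂ[X]} (h : ∀ z : ℂ, ‖z‖ = 1 → f.eval z = g.eval z) :
    f = g := by
  refine toL1_injective (congrArg (ContinuousMap.toLp 1 haarAddCircle ℂ) (ContinuousMap.ext ?_))
  intro t
  simpa only [AlgHom.toLinearMap_apply, toAddCircle_apply] using h _ (Circle.norm_coe t.toCircle)

lemma mul_pStar_eq_of_im_eval_mul_conj_eq_zero {N : ℕ} {f p : ℂ[X]} (hf : f.natDegree ≤ N)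
    (hp : p.natDegree ≤ N) (h : ∀ z : ℂ, ‖z‖ = 1 → (f.eval z * conj (p.eval z)).im = 0) :
    f * pStar N p = pStar N f * p := by
  refine eq_of_eval_eq_on_circle fun z hz => ?_
  have hreal := Complex.conj_eq_iff_im.2 (h z hz)
  simp only [map_mul, Complex.conj_conj] at hreal
  rw [eval_mul, eval_mul, eval_pStar hf hz, eval_pStar hp hz]
  linear_combination -z ^ N * hreal

lemma norm_toL1 (f : ℂ[X]) :
    ‖toL1 f‖ = ∫ t : AddCircle (2 * π), ‖f.toAddCircle t‖ ∂haarAddCircle := by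
  rw [L1.norm_eq_integral_norm]
  refine integral_congr_ae ?_
  filter_upwards [ContinuousMap.coeFn_toLp (p := 1) (𝕜 := ℂ) haarAddCircle f.toAddCircle] with t ht
  exact congrArg norm ht

lemma ne_zero_of_norm_toL1_eq_one {f : ℂ[X]} (h : ‖toL1 f‖ = 1) : f ≠ 0 := by
  rintro rfl
  simp at h

lemma norm_add_eq_iff_mul_conj_nonneg {x y : ℂ} :
    ‖x + y‖ = ‖x‖ + ‖y‖ ↔ 0 ≤ x * conj y := by
  have hsq := Complex.normSq_add x y
  simp only [Complex.normSq_eq_norm_sq] at hsq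
  have hmul : ‖x * conj y‖ = ‖x‖ * ‖y‖ := by rw [norm_mul, RCLike.norm_conj]
  rw [← Complex.re_eq_norm, hmul, ← sq_eq_sq₀ (norm_nonneg _) (by positivity)]
  constructor <;> intro h <;> linarith

lemma norm_toL1_add_eq_iff {f g : ℂ[X]} :
    ‖toL1 (f + g)‖ = ‖toL1 f‖ + ‖toL1 g‖ ↔
      ∀ z : ℂ, ‖z‖ = 1 → 0 ≤ f.eval z * conj (g.eval z) := by
  have hint (q : ℂ[X]) := (toAddCircle.integrable q).norm
  have hcont (q : ℂ[X]) : Continuous fun t => ‖q.toAddCircle t‖ := q.toAddCircle.continuous.norm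
  rw [norm_toL1, norm_toL1, norm_toL1, ← integral_add (hint f) (hint g),
    integral_eq_iff_of_ae_le (hint _) (by exact (hint f).add (hint g))
      (.of_forall fun t => by simpa using norm_add_le _ _),
    (hcont _).ae_eq_iff_eq _ (by fun_prop), funext_iff]
  simp only [map_add, ContinuousMap.add_apply, norm_add_eq_iff_mul_conj_nonneg, toAddCircle_apply]
  exact forall_toCircle_iff (P := fun z => 0 ≤ f.eval z * conj (g.eval z))

lemma IsExtremePt.exists_eq_smul {X : Type*} [NormedAddCommGroup X] [NormedSpace ℝ X] {x y : X}
    (hx : IsExtremePt x) (h : ‖x + y‖ + ‖x - y‖ = 2) : ∃ c : ℝ, y = c • x := by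
  rcases eq_or_ne (x + y) 0 with hadd | hadd
  · exact ⟨-1, by rw [neg_one_smul, eq_neg_of_add_eq_zero_right hadd]⟩
  rcases eq_or_ne (x - y) 0 with hsub | hsub
  · exact ⟨1, by rw [one_smul, sub_eq_zero.1 hsub]⟩
  have hpos := norm_pos_iff.2 hadd
  have hmem {z : X} (hz : z ≠ 0) : ‖z‖⁻¹ • z ∈ Metric.closedBall (0 : X) 1 := by
    simpa using (norm_smul_inv_norm (𝕜 := ℝ) hz).le
  have heq : ‖x + y‖⁻¹ • (x + y) = x := by
    refine hx.2 (hmem hadd) (hmem hsub) ⟨‖x + y‖ / 2, ‖x - y‖ / 2, half_pos hpos,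
      half_pos (norm_pos_iff.2 hsub), by linarith, ?_⟩
    rw [smul_smul, smul_smul, div_mul_eq_mul_div, div_mul_eq_mul_div, mul_inv_cancel₀ hpos.ne',
      mul_inv_cancel₀ (norm_ne_zero_iff.2 hsub)]
    module
  refine ⟨‖x + y‖ - 1, ?_⟩
  rw [inv_smul_eq_iff₀ hpos.ne'] at heq
  rw [sub_smul, one_smul, ← heq, add_sub_cancel_left]

lemma isExtremePt_of_norm_eq_one {X : Type*} [NormedAddCommGroup X] [NormedSpace ℝ X] {x : X}
    (hx : ‖x‖ = 1) (h : ∀ y : X, ‖x + y‖ + ‖x - y‖ = 2 → ∃ c : ℝ, y = c • x) : IsExtremePt x := by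
  refine ⟨by simp [hx], fun x₁ hx₁ x₂ hx₂ ⟨s, t, hs, ht, hst, hcomb⟩ => ?_⟩
  rw [mem_closedBall_zero_iff] at hx₁ hx₂
  have htri := norm_add_le (s • x₁) (t • x₂)
  rw [hcomb, hx, norm_smul, norm_smul, Real.norm_of_nonneg hs.le, Real.norm_of_nonneg ht.le] at htri
  have hadd : x + (s • x₁ - t • x₂) = (2 * s) • x₁ := by rw [← hcomb]; module
  have hsub : x - (s • x₁ - t • x₂) = (2 * t) • x₂ := by rw [← hcomb]; module
  have hnadd : ‖(2 * s) • x₁‖ = 2 * s := by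
    rw [norm_smul, Real.norm_of_nonneg (by positivity)]
    nlinarith
  have hnsub : ‖(2 * t) • x₂‖ = 2 * t := by
    rw [norm_smul, Real.norm_of_nonneg (by positivity)]
    nlinarith
  obtain ⟨c, hc⟩ := h (s • x₁ - t • x₂) (by rw [hadd, hsub, hnadd, hnsub]; linarith)
  rw [hc, show x + c • x = (1 + c) • x by module] at hadd
  rw [hc, show x - c • x = (1 - c) • x by module] at hsub
  rw [← hadd, norm_smul, hx, mul_one, Real.norm_eq_abs] at hnadd
  rw [← hsub, norm_smul, hx, mul_one, Real.norm_eq_abs] at hnsub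
  have hcs : 1 + c = 2 * s := by grind
  rw [hcs] at hadd
  exact (smul_right_injective X (mul_pos two_pos hs).ne' hadd).symm

lemma isExposedPt_of_norm_eq_one {X : Type*} [NormedAddCommGroup X] [NormedSpace ℂ X] {x : X}
    (hx : ‖x‖ = 1) (h : ∀ y : X, ‖x + y‖ = ‖x‖ + ‖y‖ → ∃ c : ℂ, y = c • x) : IsExposedPt x := by
  obtain ⟨φ, hφ, hφx⟩ := exists_dual_vector ℂ x (by simp [hx])
  rw [hx, RCLike.ofReal_one] at hφx
  refine ⟨φ, hφ, Set.eq_singleton_iff_unique_mem.2 ⟨⟨by simp [hx], hφx⟩, fun y ⟨hy, hφy⟩ => ?_⟩⟩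
  have hle (z : X) : ‖φ z‖ ≤ ‖z‖ := by simpa [hφ] using φ.le_opNorm z
  have hy : ‖y‖ ≤ 1 := by simpa using hy
  have hy' : 1 ≤ ‖y‖ := by simpa [hφy] using hle y
  have hadd : 2 ≤ ‖x + y‖ := by simpa [hφx, hφy, one_add_one_eq_two] using hle (x + y)
  obtain ⟨c, rfl⟩ := h y (le_antisymm (norm_add_le x y) (by linarith))
  have hc : c = 1 := by simpa [hφx] using hφy
  rw [hc, one_smul]

lemma IsExposedPt.isExtremePt {X : Type*} [NormedAddCommGroup X] [NormedSpace ℂ X] [Module ℝ X]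
    [IsScalarTower ℝ ℂ X] {x : X} (hx : IsExposedPt x) : IsExtremePt x := by
  obtain ⟨φ, hφ, hset⟩ := hx
  obtain ⟨⟨hx, hφx⟩, huniq⟩ := Set.eq_singleton_iff_unique_mem.1 hset
  refine exposedPoints_subset_extremePoints
    ⟨hx, Complex.reCLM.comp (φ.restrictScalars ℝ), fun y hy => ?_⟩
  have hle : ‖φ y‖ ≤ 1 := by
    simpa [hφ] using φ.le_of_opNorm_le_of_le hφ.le (mem_closedBall_zero_iff.1 hy)
  have hre := Complex.re_le_norm (φ y)
  simp only [ContinuousLinearMap.comp_apply, ContinuousLinearMap.coe_restrictScalars', hφx,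
    Complex.reCLM_apply, Complex.one_re]
  refine ⟨hre.trans hle, fun hge => huniq y ⟨hy, ?_⟩⟩
  have hnonneg := Complex.re_eq_norm.1 (hre.antisymm (hle.trans hge))
  exact Complex.ext (le_antisymm (hre.trans hle) hge) (Complex.nonneg_iff.1 hnonneg).2.symm

lemma add_mul_conj_sub_nonneg_iff {a b : ℂ} :
    0 ≤ (a + b) * conj (a - b) ↔ (b * conj a).im = 0 ∧ ‖b‖ ≤ ‖a‖ := by
  have him : ((a + b) * conj (a - b)).im = 2 * (b * conj a).im := by
    simp only [Complex.mul_im, Complex.add_re, Complex.add_im, Complex.conj_re, Complex.conj_im,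
      Complex.sub_re, Complex.sub_im]
    ring
  have hre : ((a + b) * conj (a - b)).re = ‖a‖ ^ 2 - ‖b‖ ^ 2 := by
    rw [← Complex.normSq_eq_norm_sq, ← Complex.normSq_eq_norm_sq]
    simp only [Complex.normSq_apply, Complex.mul_re, Complex.add_re, Complex.add_im,
      Complex.conj_re, Complex.conj_im, Complex.sub_re, Complex.sub_im]
    ring
  rw [Complex.nonneg_iff, hre, him, sub_nonneg, sq_le_sq₀ (norm_nonneg _) (norm_nonneg _), and_comm,
    eq_comm, mul_eq_zero, or_iff_right two_ne_zero]

section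

variable {Λ : Set ℕ} {p : ℂ[X]} (hp : p ∈ polys Λ) (hnorm : ‖toL1 p‖ = 1)

include hnorm

lemma isExtremePt_toPSpace_iff :
    IsExtremePt (toPSpace Λ p hp) ↔ ∀ q ∈ polys Λ,
      (∀ z : ℂ, ‖z‖ = 1 → (q.eval z * conj (p.eval z)).im = 0 ∧ ‖q.eval z‖ ≤ ‖p.eval z‖) →
        ∃ c : ℝ, q = c • p := by
  have hsum (q : ℂ[X]) : ‖toL1 p + toL1 q‖ + ‖toL1 p - toL1 q‖ = 2 ↔
      ∀ z : ℂ, ‖z‖ = 1 → (q.eval z * conj (p.eval z)).im = 0 ∧ ‖q.eval z‖ ≤ ‖p.eval z‖ := by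
    simp only [← add_mul_conj_sub_nonneg_iff, ← eval_add, ← eval_sub, ← norm_toL1_add_eq_iff]
    rw [add_add_sub_cancel, ← two_smul ℂ, map_smul, norm_smul, hnorm, map_add, map_sub]
    norm_num [eq_comm]
  constructor
  · intro hext q hq hpq
    obtain ⟨c, hc⟩ := hext.exists_eq_smul (y := toPSpace Λ q hq) ((hsum q).2 hpq)
    exact ⟨c, toL1_injective ((congrArg Subtype.val hc).trans (toL1.map_smul_of_tower c p).symm)⟩
  · refine fun h => isExtremePt_of_norm_eq_one hnorm ?_
    rintro ⟨_, q, hq, rfl⟩ hpq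
    obtain ⟨c, rfl⟩ := h q hq ((hsum q).1 hpq)
    exact ⟨c, Subtype.ext (toL1.map_smul_of_tower c p)⟩

lemma isExposedPt_toPSpace_of_forall
    (h : ∀ q ∈ polys Λ, (∀ z : ℂ, ‖z‖ = 1 → 0 ≤ q.eval z * conj (p.eval z)) →
      ∃ c : ℝ, q = c • p) :
    IsExposedPt (toPSpace Λ p hp) := by
  refine isExposedPt_of_norm_eq_one hnorm ?_
  rintro ⟨_, q, hq, rfl⟩ (hadd : ‖toL1 p + toL1 q‖ = ‖toL1 p‖ + ‖toL1 q‖)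
  rw [add_comm, ← map_add, add_comm ‖_‖, norm_toL1_add_eq_iff] at hadd
  obtain ⟨c, rfl⟩ := h q hq hadd
  exact ⟨c, Subtype.ext (toL1.map_smul_of_tower c p)⟩

end

lemma exists_norm_eval_le_mul_norm_eval (f : ℂ[X]) {g : ℂ[X]}
    (hg : ∀ z : ℂ, ‖z‖ = 1 → g.eval z ≠ 0) :
    ∃ B > 0, ∀ z : ℂ, ‖z‖ = 1 → ‖f.eval z‖ ≤ B * ‖g.eval z‖ := by
  obtain ⟨B, hB⟩ := (isCompact_sphere (0 : ℂ) 1).exists_bound_of_continuousOn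
    (f.continuous.continuousOn.div g.continuous.continuousOn
      fun z hz => hg z (mem_sphere_zero_iff_norm.1 hz))
  refine ⟨max B 1, by positivity, fun z hz => ?_⟩
  have hquot := hB z (mem_sphere_zero_iff_norm.2 hz)
  rw [Pi.div_apply, norm_div, div_le_iff₀ (norm_pos_iff.2 (hg z hz))] at hquot
  exact hquot.trans (by gcongr; exact le_max_left B 1)

lemma mem_polys_freqs_iff {N M : ℕ} {k : Fin M → ℕ} {f : ℂ[X]} :
    f ∈ polys (freqs N k) ↔ f.natDegree ≤ N ∧ ∀ j, f.coeff (k j) = 0 := by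
  constructor
  · intro hf
    exact ⟨natDegree_le_iff_coeff_eq_zero.2 fun n hn => hf n fun hmem => hn.not_ge hmem.1,
      fun j => hf _ fun hmem => hmem.2 j rfl⟩
  · rintro ⟨hdeg, hcoeff⟩ n hn
    rcases lt_or_ge N n with hNn | hNn
    · exact coeff_eq_zero_of_natDegree_lt (hdeg.trans_lt hNn)
    · obtain ⟨j, rfl⟩ : ∃ j, n = k j := by simpa [freqs, hNn] using hn
      exact hcoeff j

section

variable {N M : ℕ} {k : Fin M → ℕ} {p : ℂ[X]}

lemma exists_eq_smul_of_rank_blockMatrix {d : ℕ} {Γ Q f : ℂ[X]} (hp0 : p ≠ 0)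
    (hp : p ∈ polys (freqs N k)) (hΓ : Γ ∈ selfInversives (2 * d)) (hΓQ : Γ * Q = p)
    (hdisk : ∀ w, ‖w‖ < 1 → Γ.rootMultiplicity w = commonMult N p w)
    (hrank : (blockMatrix k d Q).rank = 2 * d) (hf : f ∈ polys (freqs N k))
    (hreal : ∀ z : ℂ, ‖z‖ = 1 → (f.eval z * conj (p.eval z)).im = 0)
    (hcirc : f ≠ 0 → ∀ w, ‖w‖ = 1 →
      p.rootMultiplicity w ≤ f.rootMultiplicity w + Γ.rootMultiplicity w) :
    ∃ c : ℝ, f = c • p := by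
  rcases eq_or_ne f 0 with rfl | hf0
  · exact ⟨0, (zero_smul ℝ p).symm⟩
  obtain ⟨hpdeg, hpcoeff⟩ := mem_polys_freqs_iff.1 hp
  obtain ⟨hfdeg, hfcoeff⟩ := mem_polys_freqs_iff.1 hf
  obtain ⟨S, hS, rfl⟩ := exists_selfInversive_mul_eq hp0 hpdeg hΓ hΓQ hdisk hf0 hfdeg
    (mul_pStar_eq_of_im_eval_mul_conj_eq_zero hfdeg hpdeg hreal) (hcirc hf0)
  obtain ⟨c, rfl⟩ := (rank_blockMatrix_eq_iff k d Q (left_ne_zero_of_mul (hΓQ ▸ hp0)) hΓ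
    (by rwa [hΓQ])).1 hrank S hS hfcoeff
  exact ⟨c, by rw [smul_mul_assoc, hΓQ]⟩

lemma IsExtremePt.exists_eq_smul_of_norm_eval_le {Λ : Set ℕ} {q : ℂ[X]} {hp : p ∈ polys Λ}
    (hext : IsExtremePt (toPSpace Λ p hp)) (hnorm : ‖toL1 p‖ = 1) (hq : q ∈ polys Λ)
    (hreal : ∀ z : ℂ, ‖z‖ = 1 → (q.eval z * conj (p.eval z)).im = 0) {B : ℝ} (hB : 0 < B)
    (hle : ∀ z : ℂ, ‖z‖ = 1 → ‖q.eval z‖ ≤ B * ‖p.eval z‖) : ∃ c : ℝ, q = c • p := by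
  obtain ⟨c, hc⟩ := (isExtremePt_toPSpace_iff hp hnorm).1 hext (B⁻¹ • q)
    ((polys Λ).smul_of_tower_mem _ hq) fun z hz => by
      rw [eval_smul, smul_mul_assoc, Complex.smul_im, hreal z hz, smul_zero, norm_smul,
        Real.norm_of_nonneg (inv_nonneg.2 hB.le)]
      exact ⟨rfl, (inv_mul_le_iff₀ hB).2 (hle z hz)⟩
  exact ⟨B * c, by rw [mul_smul, ← hc, smul_inv_smul₀ hB.ne']⟩

lemma rank_matM_of_isExtremePt {hp : p ∈ polys (freqs N k)} (hnorm : ‖toL1 p‖ = 1)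
    (hext : IsExtremePt (toPSpace (freqs N k) p hp)) : (matM N k p).rank = 2 * m N p := by
  have hp0 := ne_zero_of_norm_toL1_eq_one hnorm
  obtain ⟨hpdeg, hpcoeff⟩ := mem_polys_freqs_iff.1 hp
  have hGR := G_mul_R hp0 hpdeg
  have hGz (z : ℂ) (hz : ‖z‖ = 1) : (G N p).eval z ≠ 0 := fun hroot =>
    ((rootMultiplicity_pos G_ne_zero).2 hroot).ne' (rootMultiplicity_G_of_norm_eq_one hz)
  refine (rank_blockMatrix_eq_iff k _ _ G_ne_zero G_mem_selfInversives (by rwa [hGR])).2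
    fun S hS hScoeff => ?_
  have hdeg : (S * R N p).natDegree ≤ N :=
    natDegree_mul_le.trans ((Nat.add_le_add_right hS.1 _).trans
      (natDegree_add_natDegree_R_le hp0 hpdeg))
  obtain ⟨B, hB, hSG⟩ := exists_norm_eval_le_mul_norm_eval S hGz
  have hreal (z : ℂ) (hz : ‖z‖ = 1) : ((S * R N p).eval z * conj (p.eval z)).im = 0 := by
    have hnormSq : (S * R N p).eval z * conj ((G N p * R N p).eval z) =
        S.eval z * conj ((G N p).eval z) * (Complex.normSq ((R N p).eval z) : ℝ) := by
      rw [eval_mul, eval_mul, map_mul, Complex.normSq_eq_conj_mul_self]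
      ring
    rw [← congrArg (eval z) hGR, hnormSq, Complex.im_mul_ofReal,
      im_eval_mul_conj_eq_zero hS G_mem_selfInversives hz, zero_mul]
  have hle (z : ℂ) (hz : ‖z‖ = 1) : ‖(S * R N p).eval z‖ ≤ B * ‖p.eval z‖ := calc
    ‖(S * R N p).eval z‖ = ‖S.eval z‖ * ‖(R N p).eval z‖ := by rw [eval_mul, norm_mul]
    _ ≤ B * ‖(G N p).eval z‖ * ‖(R N p).eval z‖ := by gcongr; exact hSG z hz
    _ = B * ‖p.eval z‖ := by rw [mul_assoc, ← norm_mul, ← eval_mul, hGR]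
  obtain ⟨c, hc⟩ := hext.exists_eq_smul_of_norm_eval_le hnorm
    (mem_polys_freqs_iff.2 ⟨hdeg, hScoeff⟩) hreal hB hle
  refine ⟨c, mul_right_cancel₀ (right_ne_zero_of_mul (hGR ▸ hp0)) ?_⟩
  rw [smul_mul_assoc, hGR, hc]

lemma isExtremePt_of_rank_matM {hp : p ∈ polys (freqs N k)} (hnorm : ‖toL1 p‖ = 1)
    (hrank : (matM N k p).rank = 2 * m N p) : IsExtremePt (toPSpace (freqs N k) p hp) := by
  have hp0 := ne_zero_of_norm_toL1_eq_one hnorm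
  refine (isExtremePt_toPSpace_iff hp hnorm).2 fun q hq hqp => ?_
  exact exists_eq_smul_of_rank_blockMatrix hp0 hp G_mem_selfInversives
    (G_mul_R hp0 (mem_polys_freqs_iff.1 hp).1) (fun _ => rootMultiplicity_G_of_norm_lt_one) hrank hq
    (fun z hz => (hqp z hz).1) fun hq0 w hw => (rootMultiplicity_le_of_norm_eval_le hq0
      (B := 1) (fun z hz => (hqp z hz).2.trans_eq (one_mul _).symm) hw).trans (Nat.le_add_right _ _)

lemma isExposedPt_of_rank_matMTilde {hp : p ∈ polys (freqs N k)} (hnorm : ‖toL1 p‖ = 1)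
    (hrank : (matMTilde N k p).rank = 2 * mTilde N p) :
    IsExposedPt (toPSpace (freqs N k) p hp) := by
  have hp0 := ne_zero_of_norm_toL1_eq_one hnorm
  refine isExposedPt_toPSpace_of_forall hp hnorm fun q hq hqp => ?_
  refine exists_eq_smul_of_rank_blockMatrix hp0 hp GTilde_mem_selfInversives
    (GTilde_mul_RTilde hp0 (mem_polys_freqs_iff.1 hp).1)
    (fun _ => rootMultiplicity_GTilde_of_norm_lt_one) hrank hq
    (fun z hz => (Complex.nonneg_iff.1 (hqp z hz)).2.symm) fun hq0 w hw => ?_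
  have heven := even_rootMultiplicity_add_of_nonneg hq0 hp0 hqp hw
  rw [rootMultiplicity_GTilde_of_norm_eq_one hw, halfMult]
  grind

end

section

variable {N : ℕ} {p : ℂ[X]} (hsimple : ∀ ζ : ℂ, ‖ζ‖ = 1 → p.rootMultiplicity ζ ≤ 1)

include hsimple

lemma halfMult_eq_zero_of_mem_circleZeros {ζ : ℂ} (hζ : ζ ∈ circleZeros p) : halfMult p ζ = 0 :=
  Nat.div_eq_of_lt (Nat.lt_succ_of_le (hsimple ζ (norm_eq_one_of_mem_circleZeros hζ)))

lemma mTilde_eq_m : mTilde N p = m N p := by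
  rw [mTilde, Finset.sum_eq_zero fun ζ => halfMult_eq_zero_of_mem_circleZeros hsimple, add_zero]

lemma RTilde_eq_R : RTilde N p = R N p := by
  rw [RTilde, R, GTilde, G0, Finset.prod_eq_one fun ζ hζ => ?_, mul_one]
  rw [halfMult_eq_zero_of_mem_circleZeros hsimple hζ, pow_zero, pow_zero, mul_one]

end

lemma blockMatrix_submatrix_cast {M : ℕ} (k : Fin M → ℕ) {d e : ℕ} (f : ℂ[X]) (h : d = e) :
    (blockMatrix k d f).submatrix id
      (Sum.map (Fin.cast (congrArg (· + 1) h.symm)) (Fin.cast h.symm)) = blockMatrix k e f := by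
  subst h
  ext i (j | j) <;> rfl

end Fewnomial

open Fewnomial in
theorem proposition3p3_general {N M : ℕ} {k : Fin M → ℕ} {p : ℂ[X]} (hp : p ∈ polys (freqs N k))
    (hnorm : ‖toL1 p‖ = 1) :
    (IsExtremePt (toPSpace (freqs N k) p hp) ↔ (matM N k p).rank = 2 * m N p) ∧
    ((matMTilde N k p).rank = 2 * mTilde N p → IsExposedPt (toPSpace (freqs N k) p hp)) ∧
    ((∀ ζ : ℂ, ‖ζ‖ = 1 → p.rootMultiplicity ζ ≤ 1) →
      (IsExposedPt (toPSpace (freqs N k) p hp) ↔ IsExtremePt (toPSpace (freqs N k) p hp)) ∧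
      ∃ h : mTilde N p = m N p, (matMTilde N k p).submatrix id
        (Sum.map (Fin.cast (congrArg (· + 1) h.symm)) (Fin.cast h.symm)) = matM N k p) := by
  have hext : IsExtremePt (toPSpace (freqs N k) p hp) ↔ (matM N k p).rank = 2 * m N p :=
    ⟨rank_matM_of_isExtremePt hnorm, isExtremePt_of_rank_matM hnorm⟩
  refine ⟨hext, isExposedPt_of_rank_matMTilde hnorm, fun hsimple => ?_⟩
  have hm : mTilde N p = m N p := mTilde_eq_m hsimple
  have hM : (matMTilde N k p).submatrix id
      (Sum.map (Fin.cast (congrArg (· + 1) hm.symm)) (Fin.cast hm.symm)) = matM N k p := by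
    rw [matMTilde, blockMatrix_submatrix_cast k _ hm, RTilde_eq_R hsimple, matM]
  have hrank : (matMTilde N k p).rank = (matM N k p).rank := by
    rw [matMTilde, matM, RTilde_eq_R hsimple, hm]
  refine ⟨⟨IsExposedPt.isExtremePt, fun h => isExposedPt_of_rank_matMTilde hnorm ?_⟩, hm, hM⟩
  rw [hrank, hm, hext.1 h]

theorem proposition3p3 (N : ℕ) (hN : 0 < N) (M : ℕ) (k : Fin M → ℕ) (hk : StrictMono k)
    (hkN : ∀ j, 0 < k j ∧ k j < N)
    (p : ℂ[X]) (hp : p ∈ Fewnomial.polys (Fewnomial.freqs N k))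
    (hnorm : ‖Fewnomial.toL1 p‖ = 1)
    (hsimple : ∀ ζ : ℂ, ‖ζ‖ = 1 → p.rootMultiplicity ζ ≤ 1) :
    (Fewnomial.IsExposedPt (Fewnomial.toPSpace (Fewnomial.freqs N k) p hp) ↔
      Fewnomial.IsExtremePt (Fewnomial.toPSpace (Fewnomial.freqs N k) p hp)) ∧
    (∃ h : Fewnomial.mTilde N p = Fewnomial.m N p,
      (Fewnomial.matMTilde N k p).submatrix id
        (Sum.map (Fin.cast (congrArg (· + 1) h.symm)) (Fin.cast h.symm)) =
          Fewnomial.matM N k p) ∧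
    (Fewnomial.IsExtremePt (Fewnomial.toPSpace (Fewnomial.freqs N k) p hp) ↔
      (Fewnomial.matM N k p).rank = 2 * Fewnomial.m N p) ∧
    ((Fewnomial.matMTilde N k p).rank = 2 * Fewnomial.mTilde N p →
      Fewnomial.IsExposedPt (Fewnomial.toPSpace (Fewnomial.freqs N k) p hp)) := by
  obtain ⟨hext, hexp, hsimp⟩ := proposition3p3_general hp hnorm
  exact ⟨(hsimp hsimple).1, (hsimp hsimple).2, hext, hexp⟩
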